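/- Let $H$ be a complex Hilbert space with an orthonormal basis $E=(e_n)_{n\in\mathbb{N}}$ (so $H$ is separable and infinite dimensional), let $S_{\mathbb{N}}$ be the group of all permutations of $\mathbb{N}$, and let $\pi: S_{\mathbb{N}}\to B(H)$ be the standard unitary representation, determined by $\pi(\rho)e_n=e_{\rho(n)}$ for all $\rho\in S_{\mathbb{N}}$ and $n\in\mathbb{N}$. Let $\mathbb{C}[\pi(S_{\mathbb{N}})]\subseteq B(H)$ be the group algebra, that is, the set of all finite complex linear combinations of the operators $\pi(\rho)$, $\rho\in S_{\mathbb{N}}$, and let $U(H)$ be the group of unitary operators on $H$. Then $\mathbb{C}[\pi(S_{\mathbb{N}})]$ is dense in $B(H)$ in the strong operator topology. Moreover, $\mathbb{C}[\pi(S_{\mathbb{N}})]\cap U(H)$ is dense in $U(H)$ in the strong operator topology. -/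

import Mathlib

noncomputable section

namespace StandardRep

variable {H : Type*} [NormedAddCommGroup H] [InnerProductSpace ℂ H] [CompleteSpace H]

/-- The orthonormal basis `n ↦ e (ρ n)` obtained by permuting the orthonormal basis `e`. -/
def permBasis (e : HilbertBasis ℕ ℂ H) (ρ : Equiv.Perm ℕ) : HilbertBasis ℕ ℂ H :=
  HilbertBasis.mk (v := fun n => e (ρ n)) (e.orthonormal.comp ρ ρ.injective) (by
    have h : Set.range (fun n => e (ρ n)) = Set.range e := ρ.surjective.range_comp e
    rw [h, e.dense_span])

theorem permBasis_apply (e : HilbertBasis ℕ ℂ H) (ρ : Equiv.Perm ℕ) (n : ℕ) :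
    permBasis e ρ n = e (ρ n) := by
  simp [permBasis]

/-- The unitary `e n ↦ e (ρ n)`, as a linear isometric automorphism of `H`. -/
def permIsometry (e : HilbertBasis ℕ ℂ H) (ρ : Equiv.Perm ℕ) : H ≃ₗᵢ[ℂ] H :=
  e.repr.trans (permBasis e ρ).repr.symm

theorem permIsometry_apply (e : HilbertBasis ℕ ℂ H) (ρ : Equiv.Perm ℕ) (n : ℕ) :
    permIsometry e ρ (e n) = e (ρ n) := by
  have h : permIsometry e ρ (e n) = (permBasis e ρ).repr.symm (e.repr (e n)) := rfl
  rw [h, e.repr_self, HilbertBasis.repr_symm_single, permBasis_apply]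

/-- Linear isometric automorphisms which agree on an orthonormal basis are equal. -/
theorem isometry_ext (e : HilbertBasis ℕ ℂ H) {u v : H ≃ₗᵢ[ℂ] H}
    (h : ∀ n, u (e n) = v (e n)) : u = v := by
  have hd : Dense (Submodule.span ℂ (Set.range e) : Set H) :=
    Submodule.dense_iff_topologicalClosure_eq_top.mpr e.dense_span
  have key : (u.toContinuousLinearEquiv : H →L[ℂ] H) = v.toContinuousLinearEquiv :=
    ContinuousLinearMap.ext_on hd (by rintro _ ⟨n, rfl⟩; exact h n)
  ext x
  exact DFunLike.congr_fun key x

/-- The standard unitary representation `π` of the group of all permutations of `ℕ` on `H`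
with respect to the orthonormal basis `e`, determined by `π ρ (e n) = e (ρ n)`. -/
def stdRep (e : HilbertBasis ℕ ℂ H) : Equiv.Perm ℕ →* unitary (H →L[ℂ] H) :=
  (Unitary.linearIsometryEquiv (𝕜 := ℂ) (H := H)).symm.toMonoidHom.comp
    { toFun := permIsometry e
      map_one' := isometry_ext e fun n => by simp [permIsometry_apply]
      map_mul' := fun ρ ν => isometry_ext e fun n => by simp [permIsometry_apply] }

theorem stdRep_apply (e : HilbertBasis ℕ ℂ H) (ρ : Equiv.Perm ℕ) (n : ℕ) :
    (stdRep e ρ : H →L[ℂ] H) (e n) = e (ρ n) :=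
  permIsometry_apply e ρ n

/-- The group algebra `ℂ[π(S_ℕ)]` in `B(H)`: the image of the group algebra of the group of all
permutations of `ℕ` under the linear extension of `π`. -/
def groupAlgebra (e : HilbertBasis ℕ ℂ H) : Subalgebra ℂ (H →L[ℂ] H) :=
  (MonoidAlgebra.lift ℂ (H →L[ℂ] H) (Equiv.Perm ℕ)
    ((unitary (H →L[ℂ] H)).subtype.comp (stdRep e))).range

/-- The closure of a set of bounded operators in the strong operator topology,
i.e. the topology of pointwise convergence in norm. -/
def strongClosure (S : Set (H →L[ℂ] H)) : Set (H →L[ℂ] H) :=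
  ContinuousLinearMap.toPointwiseConvergenceCLM ℂ (RingHom.id ℂ) H H ⁻¹'
    closure (X := H →Lₚₜ[ℂ] H)
      (ContinuousLinearMap.toPointwiseConvergenceCLM ℂ (RingHom.id ℂ) H H '' S)

/-- `S` is a strongly dense subset of `T`: `S` is a subset of `T`, dense in `T` for the relative
strong operator topology. -/
def IsStronglyDenseIn (S T : Set (H →L[ℂ] H)) : Prop :=
  S ⊆ T ∧ T ⊆ strongClosure S

end StandardRep

end

/-! A transposition of basis vectors is a reflection, so `1 - π(0 j)` has rank one
(`rankOne_sub_self_eq`). Left multiplication by transpositions then puts every rank-one operator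
between vectors of `sumZeroSpan e` into the algebra. That span is dense, so all rank-one operators
are norm limits, and `T` is the strong limit of the partial sums of `T (e i) ⊗ e i`.

For unitaries, the algebra contains every operator on a finite-dimensional `W ≤ sumZeroSpan e`,
extended by zero, hence also unitaries of `W` extended by the identity. Gram-Schmidt inside the
dense span gives orthonormal `a j` near `e j` and `b j` near `U (e j)`; such a unitary carrying `a`
to `b` is close to `U` on finitely many basis vectors. -/

open Filter Topology InnerProductSpace

namespace StandardRep

/-! ### Perturbation and extension of orthonormal families -/

section GramSchmidt

variable {E : Type*} [NormedAddCommGroup E] [InnerProductSpace ℂ E]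

/-- The Gram-Schmidt process is continuous at orthonormal families. -/
theorem tendsto_gramSchmidt {ι : Type*} {l : Filter ι} {x : ℕ → E} (hx : Orthonormal ℂ x)
    {y : ι → ℕ → E} (hy : ∀ j, Tendsto (fun m => y m j) l (𝓝 (x j))) (j : ℕ) :
    Tendsto (fun m => gramSchmidt ℂ (y m) j) l (𝓝 (x j)) := by
  induction j using Nat.strong_induction_on with
  | _ j ih =>
    have hdef : ∀ m, gramSchmidt ℂ (y m) j = y m j - ∑ i ∈ Finset.Iio j,
        (inner ℂ (gramSchmidt ℂ (y m) i) (y m j) / ((‖gramSchmidt ℂ (y m) i‖ : ℝ) : ℂ) ^ 2) •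
          gramSchmidt ℂ (y m) i :=
      fun m => eq_sub_of_add_eq (gramSchmidt_def'' ℂ (y m) j).symm
    simp only [hdef]
    have hsum : Tendsto (fun m => ∑ i ∈ Finset.Iio j,
        (inner ℂ (gramSchmidt ℂ (y m) i) (y m j) / ((‖gramSchmidt ℂ (y m) i‖ : ℝ) : ℂ) ^ 2) •
          gramSchmidt ℂ (y m) i) l (𝓝 (∑ i ∈ Finset.Iio j,
        (inner ℂ (x i) (x j) / ((‖x i‖ : ℝ) : ℂ) ^ 2) • x i)) := by
      refine tendsto_finsetSum _ fun i hi => ?_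
      have hi' := ih i (Finset.mem_Iio.mp hi)
      refine Tendsto.smul (Tendsto.div (hi'.inner (hy j)) ?_ ?_) hi'
      · exact ((Complex.continuous_ofReal.tendsto _).comp hi'.norm).pow 2
      · simp [hx.1 i]
    have hzero : ∑ i ∈ Finset.Iio j, (inner ℂ (x i) (x j) / ((‖x i‖ : ℝ) : ℂ) ^ 2) • x i = 0 :=
      Finset.sum_eq_zero fun i hi => by simp [hx.2 (Finset.mem_Iio.mp hi).ne]
    simpa [hzero] using (hy j).sub hsum

/-- A finite part of an orthonormal sequence is approximated by orthonormal families with members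
in a given dense subspace. -/
theorem exists_orthonormal_near {D : Submodule ℂ E} (hD : Dense (D : Set E)) {x : ℕ → E}
    (hx : Orthonormal ℂ x) (n : ℕ) {ε : ℝ} (hε : 0 < ε) :
    ∃ a : Fin n → E, Orthonormal ℂ a ∧ (∀ i, a i ∈ D) ∧ ∀ i, ‖a i - x i‖ < ε := by
  have hseq : ∀ j, ∃ u : ℕ → E, (∀ m, u m ∈ D) ∧ Tendsto u atTop (𝓝 (x j)) := fun j =>
    mem_closure_iff_seq_limit.mp (hD (x j))
  choose u huD hu using hseq
  have hgs := tendsto_gramSchmidt hx (y := fun m j => u j m) hu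
  have hgsn : ∀ j, Tendsto (fun m => gramSchmidtNormed ℂ (fun j => u j m) j) atTop
      (𝓝 (x j)) := by
    intro j
    have h := (((Complex.continuous_ofReal.tendsto _).comp (hgs j).norm).inv₀
      (by simp [hx.1 j])).smul (hgs j)
    simpa [hx.1 j, gramSchmidtNormed] using h
  -- Finitely many indices, so one `m` serves all. Nonvanishing is required because
  -- `gramSchmidtNormed` returns `0` on degenerate input.
  have hev : ∀ᶠ m in atTop, ∀ i : Fin n,
      gramSchmidtNormed ℂ (fun j => u j m) i ≠ 0 ∧
      ‖gramSchmidtNormed ℂ (fun j => u j m) i - x i‖ < ε := by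
    refine eventually_all.mpr fun i => ?_
    refine ((hgsn i).eventually_ne (hx.ne_zero _)).and ?_
    have := (hgsn i).eventually (Metric.ball_mem_nhds _ hε)
    simpa [dist_eq_norm] using this
  obtain ⟨m, hm⟩ := hev.exists
  refine ⟨fun i => gramSchmidtNormed ℂ (fun j => u j m) i, ⟨fun i =>
    gramSchmidtNormed_unit_length' (hm i).1, fun i j hij => ?_⟩, fun i => ?_, fun i => (hm i).2⟩
  · have h := gramSchmidt_orthogonal ℂ (fun j => u j m) (Fin.val_ne_of_ne hij)
    simp [gramSchmidtNormed, inner_smul_left, inner_smul_right, h]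
  · refine D.smul_mem _ ?_
    refine Submodule.span_le.mpr ?_ (gramSchmidt_mem_span ℂ (fun j => u j m) (le_refl (i : ℕ)))
    rintro _ ⟨j, -, rfl⟩
    exact huD j m

/-- In a finite-dimensional space, any orthonormal family can be moved to any other one with the
same index set by a linear isometric automorphism. -/
theorem exists_linearIsometryEquiv_apply_eq [FiniteDimensional ℂ E] {n : ℕ} {a b : Fin n → E}
    (ha : Orthonormal ℂ a) (hb : Orthonormal ℂ b) : ∃ L : E ≃ₗᵢ[ℂ] E, ∀ i, L (a i) = b i := by
  have hn : n ≤ Module.finrank ℂ E := by simpa using ha.linearIndependent.fintype_card_le_finrank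
  have key : ∀ c : Fin n → E, Orthonormal ℂ c →
      ∃ B : OrthonormalBasis (Fin (Module.finrank ℂ E)) ℂ E,
        ∀ i, B (Fin.castLE hn i) = c i := by
    intro c hc
    obtain ⟨B, hB⟩ := Orthonormal.exists_orthonormalBasis_extension_of_card_eq (𝕜 := ℂ) (E := E)
      (ι := Fin (Module.finrank ℂ E)) (by simp)
      (v := fun k => if h : (k : ℕ) < n then c ⟨k, h⟩ else 0) (s := {k | (k : ℕ) < n}) (by
        have h := hc.comp (fun k : {k : Fin (Module.finrank ℂ E) | (k : ℕ) < n} =>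
          (⟨k.1, k.2⟩ : Fin n)) (fun k l hkl => by
            apply Subtype.ext
            apply Fin.ext
            simpa using hkl)
        convert h using 1
        funext k
        have hk : (k.1 : ℕ) < n := k.2
        simp [Set.domRestrict, hk])
    exact ⟨B, fun i => by simp [hB (Fin.castLE hn i) i.2]⟩
  obtain ⟨A, hA⟩ := key a ha
  obtain ⟨B, hB⟩ := key b hb
  exact ⟨A.equiv B (Equiv.refl _), fun i => by rw [← hA, ← hB]; simp⟩

end GramSchmidt

/-! ### Strong closure and extension by zero -/

variable {H : Type*} [NormedAddCommGroup H] [InnerProductSpace ℂ H]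

theorem ext_on_basis (e : HilbertBasis ℕ ℂ H) {S T : H →L[ℂ] H}
    (h : ∀ n, S (e n) = T (e n)) : S = T :=
  ContinuousLinearMap.ext_on (Submodule.dense_iff_topologicalClosure_eq_top.mpr e.dense_span)
    (by rintro _ ⟨n, rfl⟩; exact h n)

/-- The norm topology is finer than the strong one, so norm limits may be adjoined for free. -/
theorem strongClosure_closure (S : Set (H →L[ℂ] H)) :
    strongClosure (closure S) = strongClosure S := by
  unfold strongClosure
  congr 1
  refine subset_antisymm (closure_minimal ?_ isClosed_closure)
    (closure_mono (Set.image_mono subset_closure))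
  exact image_closure_subset_closure_image (ContinuousLinearMap.continuous _)

theorem mem_strongClosure_of_tendsto {ι : Type*} {l : Filter ι} [l.NeBot]
    {S : Set (H →L[ℂ] H)} {T : H →L[ℂ] H} {A : ι → H →L[ℂ] H} (hA : ∀ i, A i ∈ S)
    (h : ∀ x, Tendsto (fun i => A i x) l (𝓝 (T x))) : T ∈ strongClosure S := by
  have hlim : Tendsto
      (fun i => ContinuousLinearMap.toPointwiseConvergenceCLM ℂ (RingHom.id ℂ) H H (A i)) l
      (𝓝 (ContinuousLinearMap.toPointwiseConvergenceCLM ℂ (RingHom.id ℂ) H H T)) :=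
    PointwiseConvergenceCLM.tendsto_iff_forall_tendsto.mpr h
  exact mem_closure_of_tendsto (X := H →Lₚₜ[ℂ] H) hlim
    (Eventually.of_forall fun i => ⟨A i, hA i, rfl⟩)

/-- The operator which acts as `C` on the subspace `W` and as `0` on its orthogonal complement. -/
noncomputable def extendByZero (W : Submodule ℂ H) [W.HasOrthogonalProjection]
    (C : W →L[ℂ] W) : H →L[ℂ] H :=
  W.subtypeL ∘L C ∘L W.orthogonalProjectionOnto

theorem extendByZero_mul (W : Submodule ℂ H) [W.HasOrthogonalProjection] (B C : W →L[ℂ] W) :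
    extendByZero W B * extendByZero W C = extendByZero W (B * C) := by
  ext x
  simp [extendByZero]

theorem extendByZero_add (W : Submodule ℂ H) [W.HasOrthogonalProjection] (B C : W →L[ℂ] W) :
    extendByZero W (B + C) = extendByZero W B + extendByZero W C := by
  ext x
  simp [extendByZero]

variable [CompleteSpace H]

/-! ### Rank-one operators and density in `B(H)` -/

theorem stdRep_mem_groupAlgebra (e : HilbertBasis ℕ ℂ H) (ρ : Equiv.Perm ℕ) :
    (stdRep e ρ : H →L[ℂ] H) ∈ groupAlgebra e :=
  ⟨MonoidAlgebra.of ℂ _ ρ, by simp⟩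

/-- The space of finite linear combinations of basis vectors with coefficient sum zero. -/
def sumZeroSpan (e : HilbertBasis ℕ ℂ H) : Submodule ℂ H :=
  Submodule.span ℂ (Set.range fun i => e i - e 0)

/-- A vector orthogonal to all `e i - e 0` has constant coefficients, and a constant square-summable
sequence is zero. -/
theorem dense_sumZeroSpan (e : HilbertBasis ℕ ℂ H) : Dense (sumZeroSpan e : Set H) := by
  rw [Submodule.dense_iff_topologicalClosure_eq_top,
    Submodule.topologicalClosure_eq_top_iff, Submodule.eq_bot_iff]
  intro x hx
  have hconst : ∀ i, e.repr x i = e.repr x 0 := fun i => by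
    have h := (Submodule.mem_orthogonal _ _).mp hx (e i - e 0) (Submodule.subset_span ⟨i, rfl⟩)
    rw [inner_sub_left, sub_eq_zero] at h
    simpa [e.repr_apply_apply] using h
  have hsum := e.orthonormal.inner_products_summable (x := x)
  have hc : ∀ i, ‖inner ℂ (e i) x‖ ^ 2 = ‖inner ℂ (e 0) x‖ ^ 2 := fun i => by
    rw [← e.repr_apply_apply, hconst i, e.repr_apply_apply]
  simp only [hc] at hsum
  have h0 : e.repr x 0 = 0 := by
    simpa [e.repr_apply_apply] using (summable_const_iff _).mp hsum
  apply e.repr.injective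
  ext i
  simp [hconst i, h0]

/-- The swap is the reflection along `e j - e 0`, so the right side is twice a projection; the
squared norm 2 of this vector absorbs the factor. -/
theorem rankOne_sub_self_eq (e : HilbertBasis ℕ ℂ H) {j : ℕ} (hj : j ≠ 0) :
    rankOne ℂ (e j - e 0) (e j - e 0) = 1 - (stdRep e (Equiv.swap 0 j) : H →L[ℂ] H) := by
  refine ext_on_basis e fun k => ?_
  have ho := orthonormal_iff_ite.mp e.orthonormal
  simp only [rankOne_apply, inner_sub_left, ho, sub_apply,
    one_apply_eq_self, stdRep_apply]
  rcases eq_or_ne k 0 with rfl | hk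
  · simp [hj]
  rcases eq_or_ne k j with rfl | hkj
  · simp [hj.symm]
  · simp [Equiv.swap_apply_of_ne_of_ne hk hkj, hk.symm, hkj.symm]

theorem rankOne_basis_sub_mem (e : HilbertBasis ℕ ℂ H) (i j : ℕ) :
    rankOne ℂ (e i - e 0) (e j - e 0) ∈ groupAlgebra e := by
  rcases eq_or_ne i 0 with rfl | hi
  · simp
  rcases eq_or_ne j 0 with rfl | hj
  · simp
  -- As `i` and `j` are nonzero, the swap fixes `e 0` and sends `e j - e 0` to `e i - e 0`.
  have h : rankOne ℂ (e i - e 0) (e j - e 0) =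
      (stdRep e (Equiv.swap i j) : H →L[ℂ] H) * rankOne ℂ (e j - e 0) (e j - e 0) := by
    rw [ContinuousLinearMap.mul_def, comp_rankOne, map_sub (stdRep e (Equiv.swap i j) : H →L[ℂ] H),
      stdRep_apply, stdRep_apply, Equiv.swap_apply_right, Equiv.swap_apply_of_ne_of_ne hi.symm hj.symm]
  rw [h, rankOne_sub_self_eq e hj]
  exact mul_mem (stdRep_mem_groupAlgebra e _)
    (sub_mem (one_mem _) (stdRep_mem_groupAlgebra e _))

theorem rankOne_mem_groupAlgebra (e : HilbertBasis ℕ ℂ H) {x y : H} (hx : x ∈ sumZeroSpan e)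
    (hy : y ∈ sumZeroSpan e) : rankOne ℂ x y ∈ groupAlgebra e := by
  induction hx using Submodule.span_induction with
  | mem x hx =>
    obtain ⟨i, rfl⟩ := hx
    induction hy using Submodule.span_induction with
    | mem y hy =>
      obtain ⟨j, rfl⟩ := hy
      exact rankOne_basis_sub_mem e i j
    | zero => simp
    | add y z _ _ hy hz => rw [map_add]; exact add_mem hy hz
    | smul c y _ hy =>
      rw [map_smulₛₗ]
      exact Subalgebra.smul_mem _ hy _
  | zero => simp
  | add x z _ _ hx hz => rw [map_add, add_apply]; exact add_mem hx hz
  | smul c x _ hx =>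
    rw [map_smul, smul_apply]
    exact Subalgebra.smul_mem _ hx _

/-- Every operator of rank one is a norm limit of elements of the group algebra. -/
theorem rankOne_mem_closure (e : HilbertBasis ℕ ℂ H) (x y : H) :
    rankOne ℂ x y ∈ closure (groupAlgebra e : Set (H →L[ℂ] H)) := by
  have hcont : Continuous fun p : H × H => (rankOne ℂ p.1 p.2 : H →L[ℂ] H) :=
    (ContinuousLinearMap.smulRightL ℂ H H).continuous₂.comp
      (((innerSL ℂ).continuous.comp continuous_snd).prodMk continuous_fst)
  have hd : (x, y) ∈ closure ((sumZeroSpan e : Set H) ×ˢ (sumZeroSpan e : Set H)) := by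
    rw [closure_prod_eq]
    exact ⟨dense_sumZeroSpan e x, dense_sumZeroSpan e y⟩
  exact map_mem_closure (f := fun p : H × H => (rankOne ℂ p.1 p.2 : H →L[ℂ] H)) hcont hd
    fun p hp => rankOne_mem_groupAlgebra e hp.1 hp.2

theorem mem_strongClosure_groupAlgebra (e : HilbertBasis ℕ ℂ H) (T : H →L[ℂ] H) :
    T ∈ strongClosure (groupAlgebra e : Set (H →L[ℂ] H)) := by
  rw [← strongClosure_closure]
  refine mem_strongClosure_of_tendsto (l := atTop)
    (A := fun s : Finset ℕ => ∑ i ∈ s, rankOne ℂ (T (e i)) (e i)) (fun s => ?_) fun x => ?_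
  · exact sum_mem (S := (groupAlgebra e).toSubmodule.topologicalClosure)
      fun i _ => rankOne_mem_closure e _ _
  · have h := T.hasSum (e.hasSum_repr x)
    simpa [HasSum, e.repr_apply_apply, sum_apply] using h

/-! ### Unitaries in the group algebra -/

theorem extendByZero_mem_groupAlgebra (e : HilbertBasis ℕ ℂ H) {W : Submodule ℂ H}
    [FiniteDimensional ℂ W] (hW : W ≤ sumZeroSpan e) (C : W →L[ℂ] W) :
    extendByZero W C ∈ groupAlgebra e := by
  let w := stdOrthonormalBasis ℂ W
  have h : extendByZero W C = ∑ k, rankOne ℂ (C (w k) : H) (w k : H) := by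
    ext x
    have hP : W.orthogonalProjectionOnto x = ∑ k, inner ℂ (w k : H) x • w k := by
      conv_lhs => rw [← w.sum_repr' (W.orthogonalProjectionOnto x)]
      simp
    simp [extendByZero, hP]
  rw [h]
  exact sum_mem fun k _ => rankOne_mem_groupAlgebra e (hW (C (w k)).2) (hW (w k).2)

theorem star_extendByZero (W : Submodule ℂ H) [CompleteSpace W] (C : W →L[ℂ] W) :
    star (extendByZero W C) = extendByZero W (star C) := by
  simp only [extendByZero, ContinuousLinearMap.star_eq_adjoint, ContinuousLinearMap.adjoint_comp,
    Submodule.adjoint_subtypeL, Submodule.adjoint_orthogonalProjectionOnto]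
  rfl

/-- The extension of a unitary operator by the identity is unitary. -/
theorem one_add_extendByZero_mem_unitary (W : Submodule ℂ H) [CompleteSpace W] {L : W →L[ℂ] W}
    (hL : L ∈ unitary (W →L[ℂ] W)) : 1 + extendByZero W (L - 1) ∈ unitary (H →L[ℂ] H) := by
  have key : ∀ B C : W →L[ℂ] W, B * C = 1 →
      (1 + extendByZero W (B - 1)) * (1 + extendByZero W (C - 1)) = 1 := by
    intro B C h
    -- `extendByZero` is additive and multiplicative, so the non-identity terms of the product
    -- collapse to the extension of `B * C - 1`.
    have h0 : (C - 1) + ((B - 1) + (B - 1) * (C - 1)) = 0 := by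
      rw [sub_mul, mul_sub, h, mul_one, one_mul]; abel
    have hz : extendByZero W (0 : W →L[ℂ] W) = 0 := by ext x; simp [extendByZero]
    rw [add_mul, one_mul, mul_add, mul_one, extendByZero_mul, ← extendByZero_add, add_assoc,
      ← extendByZero_add, h0, hz, add_zero]
  have hs : star (1 + extendByZero W (L - 1)) = 1 + extendByZero W (star L - 1) := by
    have hsub : star (L - 1) = star L - 1 := by
      rw [ContinuousLinearMap.star_eq_adjoint, map_sub, ← ContinuousLinearMap.star_eq_adjoint,
        ← ContinuousLinearMap.star_eq_adjoint, star_one]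
    rw [star_add, star_one, star_extendByZero, hsub]
  rw [Unitary.mem_iff, hs]
  exact ⟨key _ _ (Unitary.mem_iff.mp hL).1, key _ _ (Unitary.mem_iff.mp hL).2⟩

/-- The group algebra contains unitaries which carry any finite orthonormal family in
`sumZeroSpan e` to any other. -/
theorem exists_unitary_mem_groupAlgebra (e : HilbertBasis ℕ ℂ H) {n : ℕ} {a b : Fin n → H}
    (ha : Orthonormal ℂ a) (hb : Orthonormal ℂ b) (haD : ∀ i, a i ∈ sumZeroSpan e)
    (hbD : ∀ i, b i ∈ sumZeroSpan e) :
    ∃ V ∈ groupAlgebra e, V ∈ unitary (H →L[ℂ] H) ∧ ∀ i, V (a i) = b i := by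
  let W : Submodule ℂ H := Submodule.span ℂ (Set.range a ∪ Set.range b)
  have : FiniteDimensional ℂ W :=
    FiniteDimensional.span_of_finite ℂ ((Set.finite_range a).union (Set.finite_range b))
  have hW : W ≤ sumZeroSpan e := by
    refine Submodule.span_le.mpr ?_
    rintro _ (⟨i, rfl⟩ | ⟨i, rfl⟩)
    exacts [haD i, hbD i]
  have haW : ∀ i, a i ∈ W := fun i => Submodule.subset_span (Or.inl ⟨i, rfl⟩)
  have hbW : ∀ i, b i ∈ W := fun i => Submodule.subset_span (Or.inr ⟨i, rfl⟩)
  have ha' : Orthonormal ℂ fun i => (⟨a i, haW i⟩ : W) :=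
    W.subtypeₗᵢ.orthonormal_comp_iff.mp ha
  have hb' : Orthonormal ℂ fun i => (⟨b i, hbW i⟩ : W) :=
    W.subtypeₗᵢ.orthonormal_comp_iff.mp hb
  obtain ⟨L, hL⟩ := exists_linearIsometryEquiv_apply_eq ha' hb'
  let U := (Unitary.linearIsometryEquiv (𝕜 := ℂ) (H := W)).symm L
  have hU : ∀ x, (U : W →L[ℂ] W) x = L x := fun x => rfl
  refine ⟨1 + extendByZero W (U - 1), add_mem (one_mem _) (extendByZero_mem_groupAlgebra e hW _),
    one_add_extendByZero_mem_unitary W U.2, fun i => ?_⟩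
  have hP : W.orthogonalProjectionOnto (a i) = ⟨a i, haW i⟩ :=
    Submodule.orthogonalProjectionOnto_mem_subspace_eq_self (K := W) ⟨a i, haW i⟩
  simp [extendByZero, hP, hU, hL]

/-! ### Strong approximation of unitaries -/

theorem norm_apply_of_mem_unitary {V : H →L[ℂ] H} (hV : V ∈ unitary (H →L[ℂ] H)) (x : H) :
    ‖V x‖ = ‖x‖ :=
  (Unitary.linearIsometryEquiv (⟨V, hV⟩ : unitary (H →L[ℂ] H))).norm_map x

/-- A sequence of unitaries which converges to a unitary on an orthonormal basis converges
strongly. -/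
theorem tendsto_apply_of_tendsto_basis (e : HilbertBasis ℕ ℂ H) {V : ℕ → H →L[ℂ] H}
    {U : H →L[ℂ] H} (hV : ∀ n, V n ∈ unitary (H →L[ℂ] H)) (hU : U ∈ unitary (H →L[ℂ] H))
    (h : ∀ j, Tendsto (fun n => V n (e j)) atTop (𝓝 (U (e j)))) (x : H) :
    Tendsto (fun n => V n x) atTop (𝓝 (U x)) := by
  have hspan : ∀ y ∈ Submodule.span ℂ (Set.range e),
      Tendsto (fun n => V n y) atTop (𝓝 (U y)) := by
    intro y hy
    induction hy using Submodule.span_induction with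
    | mem y hy => obtain ⟨j, rfl⟩ := hy; exact h j
    | zero => simp
    | add y z _ _ hy hz => simpa using hy.add hz
    | smul c y _ hy => simpa using hy.const_smul c
  have hd : Dense (Submodule.span ℂ (Set.range e) : Set H) :=
    Submodule.dense_iff_topologicalClosure_eq_top.mpr e.dense_span
  rw [Metric.tendsto_atTop]
  intro ε hε
  obtain ⟨y, hy, hxy⟩ := Metric.dense_iff.mp hd x (ε / 3) (by positivity)
  obtain ⟨N, hN⟩ := Metric.tendsto_atTop.mp (hspan y hxy) (ε / 3) (by positivity)
  refine ⟨N, fun n hn => ?_⟩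
  -- Unitaries are isometric, so this bound is uniform in `n`.
  have hiso : ∀ T ∈ unitary (H →L[ℂ] H), dist (T x) (T y) < ε / 3 := fun T hT => by
    rw [dist_eq_norm, ← map_sub, norm_apply_of_mem_unitary hT, ← dist_eq_norm, dist_comm]
    exact hy
  have h1 := hiso _ (hV n)
  have h2 := hiso _ hU
  rw [dist_comm] at h2
  have h3 := dist_triangle4 (V n x) (V n y) (U y) (U x)
  linarith [hN n hn]

theorem orthonormal_unitary_apply (e : HilbertBasis ℕ ℂ H) {U : H →L[ℂ] H}
    (hU : U ∈ unitary (H →L[ℂ] H)) : Orthonormal ℂ fun n => U (e n) :=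
  e.orthonormal.comp_linearIsometryEquiv
    (Unitary.linearIsometryEquiv (⟨U, hU⟩ : unitary (H →L[ℂ] H)))

theorem exists_unitary_near (e : HilbertBasis ℕ ℂ H) {U : H →L[ℂ] H}
    (hU : U ∈ unitary (H →L[ℂ] H)) (n : ℕ) {ε : ℝ} (hε : 0 < ε) :
    ∃ V ∈ (groupAlgebra e : Set (H →L[ℂ] H)) ∩ (unitary (H →L[ℂ] H) : Set (H →L[ℂ] H)),
      ∀ j < n, dist (V (e j)) (U (e j)) < ε := by
  obtain ⟨a, ha, haD, hae⟩ :=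
    exists_orthonormal_near (dense_sumZeroSpan e) e.orthonormal n (half_pos hε)
  obtain ⟨b, hb, hbD, hbU⟩ :=
    exists_orthonormal_near (dense_sumZeroSpan e) (orthonormal_unitary_apply e hU) n (half_pos hε)
  obtain ⟨V, hVA, hVU, hV⟩ := exists_unitary_mem_groupAlgebra e ha hb haD hbD
  refine ⟨V, ⟨hVA, hVU⟩, fun j hj => ?_⟩
  -- `V` carries `a j` to `b j` isometrically, so this distance is that of `e j` from `a j`.
  have h1 : dist (V (e j)) (b ⟨j, hj⟩) < ε / 2 := by
    rw [← hV, dist_eq_norm, ← map_sub, norm_apply_of_mem_unitary hVU, norm_sub_rev]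
    exact hae ⟨j, hj⟩
  have h2 : dist (b ⟨j, hj⟩) (U (e j)) < ε / 2 := by
    rw [dist_eq_norm]
    exact hbU ⟨j, hj⟩
  linarith [dist_triangle (V (e j)) (b ⟨j, hj⟩) (U (e j))]

theorem unitary_subset_strongClosure (e : HilbertBasis ℕ ℂ H) :
    (unitary (H →L[ℂ] H) : Set (H →L[ℂ] H)) ⊆ strongClosure
      ((groupAlgebra e : Set (H →L[ℂ] H)) ∩ (unitary (H →L[ℂ] H) : Set (H →L[ℂ] H))) := by
  intro U hU
  choose V hVS hV using fun n : ℕ =>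
    exists_unitary_near e hU n (Nat.one_div_pos_of_nat (α := ℝ) (n := n))
  refine mem_strongClosure_of_tendsto hVS
    (tendsto_apply_of_tendsto_basis e (fun n => (hVS n).2) hU fun j => ?_)
  rw [tendsto_iff_dist_tendsto_zero]
  -- `V n` is controlled only at indices below `n`, so the bound at `j` holds once `n > j`.
  refine squeeze_zero' (Eventually.of_forall fun _ => dist_nonneg) ?_
    (tendsto_one_div_add_atTop_nhds_zero_nat (𝕜 := ℝ))
  filter_upwards [eventually_gt_atTop j] with n hn
  exact (hV n j hn).le

end StandardRep

theorem mainTheorem9 {H : Type*} [NormedAddCommGroup H] [InnerProductSpace ℂ H] [CompleteSpace H]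
    (e : HilbertBasis ℕ ℂ H) :
    StandardRep.IsStronglyDenseIn (StandardRep.groupAlgebra e : Set (H →L[ℂ] H)) Set.univ ∧
    StandardRep.IsStronglyDenseIn
      ((StandardRep.groupAlgebra e : Set (H →L[ℂ] H)) ∩ (unitary (H →L[ℂ] H) : Set (H →L[ℂ] H)))
      (unitary (H →L[ℂ] H) : Set (H →L[ℂ] H)) :=
  ⟨⟨Set.subset_univ _, fun T _ => StandardRep.mem_strongClosure_groupAlgebra e T⟩,
    Set.inter_subset_right, StandardRep.unitary_subset_strongClosure e⟩
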